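/- For $x\ge 0$ let $$M_{1/3}(x)=\sum_{n=0}^{\infty}\frac{(-x)^n}{n!\,\Gamma\!\left(-\tfrac n3+\tfrac23\right)}=3^{2/3}\,\mathrm{Ai}\!\left(3^{-1/3}x\right)$$ be the M-Wright function of index $1/3$ (with $1/\Gamma=0$ at the poles of $\Gamma$, and $\mathrm{Ai}$ the Airy function), and let $\hat M_{1/3}(x)=\tfrac12 M_{1/3}(|x|)$, $x\in\mathbb{R}$, be its symmetrization. Let $\hat{\mathcal D}_{1/3}$ be the set of all functions $f\in C^1(\mathbb{R})$ such that $f$ and $f'$ are bounded, $f''$ exists, is continuous and is bounded on $\mathbb{R}\setminus\{0\}$, and $f(0)=0$. For $f\in\hat{\mathcal D}_{1/3}$ put $$(\hat{\mathcal A}_{1/3}f)(x)=f''(x)-\tfrac13|x|f(x),\qquad x\in\mathbb{R},$$ where $f''(0)$ is given an arbitrary fixed real value, depending only on $f$, whenever $f'$ is not differentiable at $0$. Let $X$ be a real-valued random variable with $P(X\ge 0)=P(X<0)=\tfrac12$. Then, for every choice of these values, $X$ has the distribution with density $\hat M_{1/3}$ with respect to Lebesgue measure if and only if, for every $f\in\hat{\mathcal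 D}_{1/3}$, the random variable $(\hat{\mathcal A}_{1/3}f)(X)$ is integrable and $$\mathbb{E}\big[(\hat{\mathcal A}_{1/3}f)(X)\big]=0 .$$ -/

import Mathlib

open MeasureTheory ProbabilityTheory

noncomputable section

/-- The M-Wright function `M_β(x) = ∑ (-x)^n / (n! Γ(-β n + 1 - β))`, where `1/Γ = 0` at the poles
of `Γ` (`Real.Gamma` takes the value `0` there, so the quotient below is `0`). -/
def mWright (β x : ℝ) : ℝ :=
  ∑' n : ℕ, (-x) ^ n / ((n.factorial : ℝ) * Real.Gamma (-β * n + (1 - β)))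

/-- The symmetrized density `x ↦ M_{1/3}(|x|) / 2` on the real line. -/
def mWrightSym (x : ℝ) : ℝ := (1 / 2) * mWright (1 / 3) |x|

/-- The distribution on the real line with density `mWrightSym`. -/
def mWrightSymLaw : Measure ℝ :=
  volume.withDensity fun x => ENNReal.ofReal (mWrightSym x)

/-- The test functions: `f` is `C¹` on `ℝ` with `f`, `f'` bounded, `f''` exists, is continuous
and is bounded on `ℝ \ {0}`, and `f 0 = 0`. -/
structure IsSteinTest (f : ℝ → ℝ) : Prop where
  contDiff : ContDiff ℝ 1 f
  bounded : ∃ C, ∀ x, |f x| ≤ C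
  bounded_deriv : ∃ C, ∀ x, |deriv f x| ≤ C
  differentiableAt_deriv : ∀ x, x ≠ 0 → DifferentiableAt ℝ (deriv f) x
  continuousOn_deriv2 : ContinuousOn (deriv (deriv f)) {0}ᶜ
  bounded_deriv2 : ∃ C, ∀ x, x ≠ 0 → |deriv (deriv f) x| ≤ C
  map_zero : f 0 = 0

open Classical in
/-- The second derivative of `f` at the points where `f'` is differentiable. For a test function the
only other possible point is `0`, where the value `c f` is used; `c` is an arbitrary convention. -/
def secondDeriv (c : (ℝ → ℝ) → ℝ) (f : ℝ → ℝ) (x : ℝ) : ℝ :=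
  if DifferentiableAt ℝ (deriv f) x then deriv (deriv f) x else c f

/-- The Stein operator `f ↦ f'' - |x| f / 3`. -/
def steinOp (c : (ℝ → ℝ) → ℝ) (f : ℝ → ℝ) (x : ℝ) : ℝ :=
  secondDeriv c f x - (1 / 3) * |x| * f x

end

/-! Write M for `mWright (1 / 3)`. Everything rests on the Airy-type equation M'' = (x/3) M, with M
> 0, M' ≤ 0 on the half-line and M, M' → 0 at infinity. The reflection formula turns the series into
(3/π) Im ∫ ω exp(-r³ - xrω) dr over r > 0, with ω = exp(iπ/3) (`mWright_one_third`). This gives the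
equation, since its inhomogeneity is real, and the decay, since Re ω > 0.

Direct half: on x > 0, (f'M - fM')' = (f'' - xf/3) M, so the one-sided law gives the mean -f'(0)
M(0). Reflecting f flips the sign of f'(0), and the two halves of the symmetric law cancel.

Converse: let h be bounded and continuous with mean zero under the one-sided law and under its
reflection. Then f'' - |x|f/3 = h is solved on each half-line with f(0) = f'(0) = 0 by f = Mu, u' =
M⁻² ∫₀ˣ hM. The two pieces glue to a test function (`exists_isSteinTest_steinOp_eq`), so the law of
X annihilates every such h. These h are cut out by two linear conditions, so the law of X is a
combination of the two one-sided laws (`eq_smul_add_smul_of_integral_eq_zero`), and the sign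
probabilities fix both weights at 1/2.

The delicate point is that xf must stay bounded. Mean zero turns ∫₀ˣ hM into minus a tail integral,
which is bounded by a multiple of -M'(x)/x. -/

noncomputable section

open Filter Topology Set

/-! ### An integral representation of the M-Wright function of index `1/3` -/

/-- The sixth root of unity `exp (iπ/3)`. -/
def rootSix : ℂ := Complex.exp ((Real.pi / 3 : ℝ) * Complex.I)

lemma rootSix_pow (n : ℕ) :
    rootSix ^ n = Complex.exp ((Real.pi * (n / 3) : ℝ) * Complex.I) := by
  rw [rootSix, ← Complex.exp_nat_mul]
  congr 1
  push_cast
  ring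

lemma rootSix_pow_im (n : ℕ) : (rootSix ^ n).im = Real.sin (Real.pi * (n / 3)) := by
  rw [rootSix_pow, Complex.exp_ofReal_mul_I_im]

lemma rootSix_re : rootSix.re = 1 / 2 := by
  rw [rootSix, Complex.exp_ofReal_mul_I_re, Real.cos_pi_div_three]

lemma rootSix_im : rootSix.im = √3 / 2 := by
  rw [rootSix, Complex.exp_ofReal_mul_I_im, Real.sin_pi_div_three]

lemma norm_rootSix : ‖rootSix‖ = 1 := Complex.norm_exp_ofReal_mul_I _

lemma rootSix_cube : rootSix ^ 3 = -1 := by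
  rw [rootSix_pow, ← Complex.exp_pi_mul_I]
  congr 2
  push_cast
  ring

/-- The `k`-th derivative in `x` of `ω exp (-r³ - x r ω)` with `ω = exp (iπ/3)`. -/
def airyKernel (k : ℕ) (x r : ℝ) : ℂ :=
  (-(r * rootSix)) ^ k * rootSix * Complex.exp (-(r : ℂ) ^ 3 - x * (r * rootSix))

/-- The integral of `airyKernel k x` over the positive half-line. -/
def airyIntegral (k : ℕ) (x : ℝ) : ℂ := ∫ r in Ioi (0 : ℝ), airyKernel k x r

lemma continuous_airyKernel_uncurry (k : ℕ) :
    Continuous (fun p : ℝ × ℝ => airyKernel k p.1 p.2) := by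
  unfold airyKernel; fun_prop

lemma continuous_airyKernel (k : ℕ) (x : ℝ) : Continuous (airyKernel k x) := by
  unfold airyKernel; fun_prop

lemma norm_airyKernel (k : ℕ) (x : ℝ) {r : ℝ} (hr : 0 ≤ r) :
    ‖airyKernel k x r‖ = r ^ k * Real.exp (-x * r / 2 - r ^ 3) := by
  have h : (-(r : ℂ) ^ 3 - x * (r * rootSix)).re = -x * r / 2 - r ^ 3 := by
    have : (-(r : ℂ) ^ 3 - x * (r * rootSix)) = ((-r ^ 3 : ℝ) : ℂ) - ((x * r : ℝ) : ℂ) * rootSix := by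
      push_cast; ring
    rw [this, Complex.sub_re, Complex.re_ofReal_mul, rootSix_re, Complex.ofReal_re]
    ring
  rw [airyKernel, norm_mul, norm_mul, norm_pow, norm_neg, norm_mul, norm_rootSix,
    Complex.norm_exp, h, Complex.norm_real, Real.norm_of_nonneg hr]
  ring

lemma integrableOn_pow_mul_exp_neg (k : ℕ) :
    IntegrableOn (fun r : ℝ => r ^ k * Real.exp (-r)) (Ioi 0) := by
  have := Real.GammaIntegral_convergent (s := k + 1) (by positivity)
  refine this.congr_fun (fun r _ => ?_) measurableSet_Ioi
  simp [mul_comm]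

/-- With A = |a| + 2, either r ≤ A and Ar ≤ A², or r ≥ A ≥ 1 and Ar ≤ r² ≤ r³. The bound reduces all
dominations below to Gamma integrals. -/
lemma mul_sub_cube_le (a : ℝ) {r : ℝ} (hr : 0 ≤ r) :
    a * r - r ^ 3 ≤ (|a| + 2) ^ 2 - r := by
  set A := |a| + 2
  have hA : 2 ≤ A := by simp [A]
  have h1 : a + 1 ≤ A := by linarith [le_abs_self a]
  have h2 : (a + 1) * r ≤ A * r := by gcongr
  suffices A * r ≤ r ^ 3 + A ^ 2 by linarith
  rcases le_total r A with h | h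
  · nlinarith [pow_nonneg hr 3]
  · nlinarith [mul_le_mul h h (by linarith) hr, mul_nonneg hr (sq_nonneg r), sq_nonneg A]

lemma integrableOn_pow_mul_exp_sub_cube (k : ℕ) (a : ℝ) :
    IntegrableOn (fun r : ℝ => r ^ k * Real.exp (a * r - r ^ 3)) (Ioi 0) := by
  refine ((integrableOn_pow_mul_exp_neg k).const_mul (Real.exp ((|a| + 2) ^ 2))).mono'
    (by fun_prop) ?_
  filter_upwards [ae_restrict_mem measurableSet_Ioi] with r hr
  have hr : 0 < r := hr
  rw [Real.norm_of_nonneg (by positivity)]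
  calc r ^ k * Real.exp (a * r - r ^ 3)
      ≤ r ^ k * Real.exp ((|a| + 2) ^ 2 - r) := 
        mul_le_mul_of_nonneg_left (Real.exp_le_exp.2 (mul_sub_cube_le a hr.le)) (by positivity)
    _ = _ := by rw [sub_eq_add_neg, Real.exp_add]; ring

lemma integrableOn_airyKernel (k : ℕ) (x : ℝ) : IntegrableOn (airyKernel k x) (Ioi 0) := by
  refine (integrableOn_pow_mul_exp_sub_cube k (-x / 2)).mono'
    (continuous_airyKernel k x).aestronglyMeasurable ?_
  filter_upwards [ae_restrict_mem measurableSet_Ioi] with r hr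
  rw [norm_airyKernel k x (le_of_lt hr)]
  rw [show -x * r / 2 = -x / 2 * r by ring]

lemma hasDerivAt_airyKernel (k : ℕ) (x r : ℝ) :
    HasDerivAt (fun y => airyKernel k y r) (airyKernel (k + 1) x r) x := by
  unfold airyKernel
  have h1 : HasDerivAt (fun y : ℝ => -(r : ℂ) ^ 3 - y * (r * rootSix)) (-(1 * (r * rootSix))) x :=
    ((Complex.ofRealCLM.hasDerivAt (x := x)).mul_const _).const_sub _
  refine (h1.cexp.const_mul ((-(r * rootSix)) ^ k * rootSix)).congr_deriv ?_
  ring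

lemma hasDerivAt_airyIntegral (k : ℕ) (x : ℝ) :
    HasDerivAt (airyIntegral k) (airyIntegral (k + 1) x) x := by
  refine (hasDerivAt_integral_of_dominated_loc_of_deriv_le
    -- Every y in the unit ball around x satisfies |y| ≤ |x| + 1.
    (bound := fun r => r ^ (k + 1) * Real.exp ((|x| + 1) * r - r ^ 3))
    (Metric.ball_mem_nhds x one_pos)
    (Eventually.of_forall fun y => (continuous_airyKernel k y).aestronglyMeasurable)
    (integrableOn_airyKernel k x) (F' := airyKernel (k + 1))
    (continuous_airyKernel _ x).aestronglyMeasurable ?_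
    (integrableOn_pow_mul_exp_sub_cube _ _)
    (Eventually.of_forall fun r y _ => hasDerivAt_airyKernel k y r)).2
  filter_upwards [ae_restrict_mem measurableSet_Ioi] with r hr y hy
  have hr : 0 < r := hr
  rw [norm_airyKernel _ _ hr.le]
  have hy' : |y| ≤ |x| + 1 := by
    have : |y - x| < 1 := hy
    have := abs_sub_abs_le_abs_sub y x
    linarith
  have : -y * r / 2 ≤ (|x| + 1) * r := by
    have h1 : -y / 2 ≤ |x| + 1 := by linarith [neg_abs_le y, abs_nonneg y]
    calc -y * r / 2 = (-y / 2) * r := by ring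
      _ ≤ _ := by gcongr
  gcongr

/-- The differential equation of the Airy function, up to a real inhomogeneity. -/
lemma airyIntegral_two (x : ℝ) :
    airyIntegral 2 x = (x / 3 : ℝ) * airyIntegral 0 x - 1 / 3 := by
  -- Because ω³ = -1, the r-derivative of this exponential is exactly three times the defect of the
  -- differential equation. The boundary value g(0) = 1 produces the constant 1/3.
  set g : ℝ → ℂ := fun r => Complex.exp (-(r : ℂ) ^ 3 - x * (r * rootSix)) with hg
  have hder : ∀ r : ℝ, HasDerivAt g (3 * (airyKernel 2 x r - (x / 3 : ℝ) * airyKernel 0 x r)) r := by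
    intro r
    have h1 : HasDerivAt (fun r : ℝ => (r : ℂ)) 1 r := Complex.ofRealCLM.hasDerivAt (x := r)
    have h2 := (((h1.pow 3).neg).sub ((h1.mul_const rootSix).const_mul (x : ℂ))).cexp
    refine h2.congr_deriv ?_
    simp only [airyKernel, Pi.pow_apply, Pi.neg_apply, Pi.sub_apply]
    push_cast
    linear_combination (-3 * (r : ℂ) ^ 2 * Complex.exp (-(r : ℂ) ^ 3 - x * (r * rootSix))) *
      rootSix_cube
  have hint : IntegrableOn (fun r => 3 * (airyKernel 2 x r - (x / 3 : ℝ) * airyKernel 0 x r))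
      (Ioi 0) :=
    ((integrableOn_airyKernel 2 x).sub ((integrableOn_airyKernel 0 x).const_mul _)).const_mul _
  have hlim : Tendsto g atTop (𝓝 0) := by
    rw [tendsto_zero_iff_norm_tendsto_zero]
    have hb : Tendsto (fun r => Real.exp ((|-x / 2| + 2) ^ 2) * Real.exp (-r)) atTop (𝓝 0) := by
      simpa using (Real.tendsto_exp_neg_atTop_nhds_zero).const_mul (Real.exp ((|-x / 2| + 2) ^ 2))
    refine tendsto_of_tendsto_of_tendsto_of_le_of_le' tendsto_const_nhds hb
      (Eventually.of_forall fun _ => norm_nonneg _) ?_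
    filter_upwards [eventually_ge_atTop 0] with r hr
    have h1 : ‖g r‖ = ‖airyKernel 0 x r‖ := by
      simp [airyKernel, hg, norm_rootSix]
    rw [h1, norm_airyKernel 0 x hr, ← Real.exp_add, pow_zero, one_mul]
    gcongr
    have := mul_sub_cube_le (-x / 2) hr
    linarith
  have key := integral_Ioi_of_hasDerivAt_of_tendsto
    (hder 0).continuousAt.continuousWithinAt (fun r _ => hder r) hint hlim
  rw [integral_const_mul, integral_sub (integrableOn_airyKernel 2 x)
    ((integrableOn_airyKernel 0 x).const_mul _), integral_const_mul] at key
  change 3 * (airyIntegral 2 x - _ * airyIntegral 0 x) = _ at key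
  simp [hg] at key
  push_cast
  linear_combination key / 3

lemma norm_airyIntegral_le (k : ℕ) {x : ℝ} (hx : 0 < x) :
    ‖airyIntegral k x‖ ≤ k.factorial * (2 / x) ^ (k + 1) := by
  have h1 : ∫ r in Ioi (0 : ℝ), r ^ k * Real.exp (-(x / 2 * r)) =
      k.factorial * (2 / x) ^ (k + 1) := by
    have := Real.integral_rpow_mul_exp_neg_mul_Ioi (a := k + 1) (r := x / 2) (by positivity)
      (by positivity)
    rw [Real.Gamma_nat_eq_factorial, one_div_div] at this
    have e : (2 / x) ^ ((k : ℝ) + 1) = (2 / x) ^ (k + 1) := by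
      rw [← Real.rpow_natCast]; push_cast; rfl
    rw [e, mul_comm] at this
    rw [← this]
    refine setIntegral_congr_fun measurableSet_Ioi fun r _ => ?_
    simp
  rw [← h1]
  refine norm_integral_le_of_norm_le ?_ ?_
  -- A non-integrable function has integral 0 by convention, so the positive value already computed
  -- forces integrability.
  · by_contra hcon
    have := integral_undef hcon
    rw [h1] at this
    have : 0 < (k.factorial : ℝ) * (2 / x) ^ (k + 1) := by positivity
    linarith
  · filter_upwards [ae_restrict_mem measurableSet_Ioi] with r hr
    have hr : 0 < r := hr
    rw [norm_airyKernel k x hr.le]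
    gcongr
    have : 0 < r ^ 3 := by positivity
    linarith

/-- The reflection formula. It survives at positive integers s, where the sine vanishes and
`Real.Gamma (1 - s)` is 0 by convention; this matches 1/Γ = 0 at the poles. -/
lemma inv_Gamma_one_sub {s : ℝ} (hs : 0 < s) :
    (Real.Gamma (1 - s))⁻¹ = Real.Gamma s * Real.sin (Real.pi * s) / Real.pi := by
  have hG := (Real.Gamma_pos_of_pos hs).ne'
  have h := Real.Gamma_mul_Gamma_one_sub s
  have h2 : Real.Gamma (1 - s) = Real.pi / Real.sin (Real.pi * s) / Real.Gamma s := by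
    rw [← h]; field_simp
  rw [h2, inv_div, div_div_eq_mul_div]

lemma integral_airyKernel_zero_term (n : ℕ) (x : ℝ) :
    ∫ r in Ioi (0 : ℝ), rootSix * Complex.exp (-(r : ℂ) ^ 3) *
        ((-(x * (r * rootSix))) ^ n / (n.factorial : ℂ)) =
      (((-x) ^ n / n.factorial * (Real.Gamma ((n + 1) / 3) / 3) : ℝ) : ℂ) * rootSix ^ (n + 1) := by
  have h := integral_rpow_mul_exp_neg_rpow (p := 3) (q := n) (by norm_num)
    (by linarith [(Nat.cast_nonneg n : (0 : ℝ) ≤ n)])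
  have e : ∀ r : ℝ, rootSix * Complex.exp (-(r : ℂ) ^ 3) *
        ((-(x * (r * rootSix))) ^ n / (n.factorial : ℂ)) =
      ((-x) ^ n / n.factorial * rootSix ^ (n + 1) : ℂ) *
        ((r ^ (n : ℝ) * Real.exp (-r ^ (3 : ℝ)) : ℝ) : ℂ) := by
    intro r
    have h3 : r ^ (3 : ℝ) = r ^ 3 := by
      rw [← Real.rpow_natCast]; norm_num
    rw [h3, Real.rpow_natCast]
    push_cast
    rw [show -((x : ℂ) * (r * rootSix)) = (-x) * r * rootSix by ring, mul_pow, mul_pow]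
    ring
  simp_rw [e]
  rw [integral_const_mul, integral_complex_ofReal, h]
  push_cast
  ring

/-- Expanding exp(-xrω) and integrating termwise gives Γ((n+1)/3)/3 times ωⁿ⁺¹. Its imaginary part
carries sin(π(n+1)/3), which the reflection formula converts into 1/Γ(1 - (n+1)/3). -/
lemma mWright_one_third (x : ℝ) :
    mWright (1 / 3) x = 3 / Real.pi * (airyIntegral 0 x).im := by
  have hs : HasSum (fun n : ℕ => ∫ r in Ioi (0 : ℝ), rootSix * Complex.exp (-(r : ℂ) ^ 3) *
        ((-(x * (r * rootSix))) ^ n / (n.factorial : ℂ))) (airyIntegral 0 x) := by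
    have hbs : ∀ r : ℝ, HasSum (fun n : ℕ => Real.exp (-r ^ 3) * ((|x| * r) ^ n / n.factorial))
        (Real.exp (-r ^ 3) * Real.exp (|x| * r)) := fun r => by
      have := NormedSpace.expSeries_div_hasSum_exp (𝔸 := ℝ) (|x| * r)
      rw [← Real.exp_eq_exp_ℝ] at this
      exact this.mul_left _
    refine hasSum_integral_of_dominated_convergence
      (fun n r => Real.exp (-r ^ 3) * ((|x| * r) ^ n / n.factorial)) ?_ ?_ ?_ ?_ ?_
    · intro n
      apply Continuous.aestronglyMeasurable
      fun_prop
    · intro n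
      filter_upwards [ae_restrict_mem measurableSet_Ioi] with r hr
      have hr : 0 < r := hr
      apply le_of_eq
      have : (-(r : ℂ) ^ 3) = ((-r ^ 3 : ℝ) : ℂ) := by push_cast; rfl
      rw [norm_mul, norm_mul, norm_rootSix, norm_div, norm_pow, norm_neg, norm_mul, norm_mul,
        norm_rootSix, this, Complex.norm_exp, Complex.ofReal_re]
      simp [abs_of_pos hr]
    · exact Eventually.of_forall fun r => (hbs r).summable
    · simp_rw [fun r => (hbs r).tsum_eq]
      refine (integrableOn_pow_mul_exp_sub_cube 0 |x|).congr_fun (fun r _ => ?_) measurableSet_Ioi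
      simp only [pow_zero, one_mul]
      rw [← Real.exp_add]
      ring_nf
    · refine Eventually.of_forall fun r => ?_
      have := NormedSpace.expSeries_div_hasSum_exp (𝔸 := ℂ) (-(x * (r * rootSix)))
      rw [← Complex.exp_eq_exp_ℂ] at this
      have e : airyKernel 0 x r = rootSix * Complex.exp (-(r : ℂ) ^ 3) *
          Complex.exp (-(x * (r * rootSix))) := by
        rw [airyKernel, mul_assoc rootSix, ← Complex.exp_add, pow_zero, one_mul, sub_eq_add_neg]
      rw [e]
      exact this.mul_left _
  have him := (Complex.hasSum_im hs).mul_left (3 / Real.pi)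
  rw [mWright, ← him.tsum_eq]
  congr 1
  ext n
  rw [integral_airyKernel_zero_term, Complex.im_ofReal_mul, rootSix_pow_im]
  have hG := inv_Gamma_one_sub (s := (n + 1) / 3) (by positivity)
  have e : -(1 / 3 : ℝ) * n + (1 - 1 / 3) = 1 - (n + 1) / 3 := by ring
  rw [e, div_mul_eq_div_div, div_eq_mul_inv _ (Real.Gamma _), hG]
  push_cast
  ring

/-! ### Positivity, decay and total mass of the M-Wright function of index `1/3` -/

/-- The derivative of `mWright (1 / 3)`. -/
def mWrightDeriv (x : ℝ) : ℝ := 3 / Real.pi * (airyIntegral 1 x).im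

lemma HasDerivAt.im_complex {f : ℝ → ℂ} {f' : ℂ} {x : ℝ} (h : HasDerivAt f f' x) :
    HasDerivAt (fun y => (f y).im) f'.im x :=
  Complex.imCLM.hasFDerivAt.comp_hasDerivAt x h

lemma hasDerivAt_mWright (x : ℝ) : HasDerivAt (mWright (1 / 3)) (mWrightDeriv x) x := by
  rw [funext mWright_one_third]
  exact (hasDerivAt_airyIntegral 0 x).im_complex.const_mul _

lemma hasDerivAt_mWrightDeriv (x : ℝ) :
    HasDerivAt mWrightDeriv (x / 3 * mWright (1 / 3) x) x := by
  refine ((hasDerivAt_airyIntegral 1 x).im_complex.const_mul _).congr_deriv ?_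
  rw [airyIntegral_two, mWright_one_third, Complex.sub_im, Complex.im_ofReal_mul]
  have : (1 / 3 : ℂ).im = 0 := by norm_num
  rw [this]
  ring

lemma continuous_mWright : Continuous (mWright (1 / 3)) :=
  continuous_iff_continuousAt.2 fun x => (hasDerivAt_mWright x).continuousAt

lemma continuous_mWrightDeriv : Continuous mWrightDeriv :=
  continuous_iff_continuousAt.2 fun x => (hasDerivAt_mWrightDeriv x).continuousAt

lemma abs_mWright_le {x : ℝ} (hx : 0 < x) : |mWright (1 / 3) x| ≤ 3 / Real.pi * (2 / x) := by
  rw [mWright_one_third, abs_mul, abs_of_pos (by positivity : 0 < 3 / Real.pi)]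
  gcongr
  refine (Complex.abs_im_le_norm _).trans ((norm_airyIntegral_le 0 hx).trans (le_of_eq ?_))
  simp

lemma abs_mWrightDeriv_le {x : ℝ} (hx : 0 < x) :
    |mWrightDeriv x| ≤ 3 / Real.pi * (2 / x) ^ 2 := by
  rw [mWrightDeriv, abs_mul, abs_of_pos (by positivity : 0 < 3 / Real.pi)]
  gcongr
  refine (Complex.abs_im_le_norm _).trans ((norm_airyIntegral_le 1 hx).trans (le_of_eq ?_))
  simp

lemma tendsto_const_div_atTop_zero (c : ℝ) : Tendsto (fun x : ℝ => c / x) atTop (𝓝 0) :=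
  tendsto_const_nhds.div_atTop tendsto_id

lemma tendsto_mWright : Tendsto (mWright (1 / 3)) atTop (𝓝 0) := by
  have hb : Tendsto (fun x : ℝ => 3 / Real.pi * (2 / x)) atTop (𝓝 0) := by
    simpa using (tendsto_const_div_atTop_zero 2).const_mul (3 / Real.pi)
  refine squeeze_zero_norm' ?_ hb
  filter_upwards [eventually_gt_atTop 0] with x hx using abs_mWright_le hx

lemma tendsto_mWrightDeriv : Tendsto mWrightDeriv atTop (𝓝 0) := by
  have hb : Tendsto (fun x : ℝ => 3 / Real.pi * (2 / x) ^ 2) atTop (𝓝 0) := by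
    simpa using ((tendsto_const_div_atTop_zero 2).pow 2).const_mul (3 / Real.pi)
  refine squeeze_zero_norm' ?_ hb
  filter_upwards [eventually_gt_atTop 0] with x hx using abs_mWrightDeriv_le hx

lemma mWright_zero_pos : 0 < mWright (1 / 3) 0 := by
  rw [mWright, tsum_eq_single 0 (fun n hn => by simp [hn])]
  have := Real.Gamma_pos_of_pos (s := 2 / 3) (by norm_num)
  norm_num
  exact this

lemma hasDerivAt_mWright_mul_deriv (x : ℝ) :
    HasDerivAt (fun y => mWright (1 / 3) y * mWrightDeriv y)
      (mWrightDeriv x ^ 2 + x / 3 * mWright (1 / 3) x ^ 2) x :=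
  ((hasDerivAt_mWright x).mul (hasDerivAt_mWrightDeriv x)).congr_deriv (by ring)

lemma monotoneOn_mWright_mul_deriv :
    MonotoneOn (fun y => mWright (1 / 3) y * mWrightDeriv y) (Ici 0) := by
  refine monotoneOn_of_hasDerivWithinAt_nonneg (convex_Ici 0)
    (continuous_mWright.mul continuous_mWrightDeriv).continuousOn
    (fun x _ => (hasDerivAt_mWright_mul_deriv x).hasDerivWithinAt) fun x hx => ?_
  rw [interior_Ici] at hx
  have hx : 0 < x := hx
  positivity

lemma tendsto_mWright_mul_deriv :
    Tendsto (fun y => mWright (1 / 3) y * mWrightDeriv y) atTop (𝓝 0) := by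
  simpa using tendsto_mWright.mul tendsto_mWrightDeriv

/-- A nondecreasing function with limit 0 at infinity is nonpositive. -/
lemma mWright_mul_deriv_nonpos {x : ℝ} (hx : 0 ≤ x) :
    mWright (1 / 3) x * mWrightDeriv x ≤ 0 := by
  refine ge_of_tendsto tendsto_mWright_mul_deriv ?_
  filter_upwards [eventually_ge_atTop x] with y hy
  exact monotoneOn_mWright_mul_deriv hx (hx.trans hy) hy

/-- A solution with vanishing Cauchy data at a positive point vanishes at the origin. -/
lemma mWright_ne_zero_or {b : ℝ} (hb : 0 ≤ b) : mWright (1 / 3) b ≠ 0 ∨ mWrightDeriv b ≠ 0 := by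
  by_contra! h
  -- The energy M² + M'² has derivative 2(1 + x/3) M M' ≥ -K (M² + M'²) on [0, b]. The weighted
  -- energy is therefore nondecreasing, and its vanishing at b forces M(0) = 0.
  set K := 1 + b / 3
  set e : ℝ → ℝ := fun x => (mWright (1 / 3) x ^ 2 + mWrightDeriv x ^ 2) * Real.exp (K * x)
  have hd : ∀ x, HasDerivAt e ((2 * (mWright (1 / 3) x * mWrightDeriv x) * (1 + x / 3) +
      K * (mWright (1 / 3) x ^ 2 + mWrightDeriv x ^ 2)) * Real.exp (K * x)) x := fun x => by
    have h3 : HasDerivAt (fun y => Real.exp (K * y)) (Real.exp (K * x) * (K * 1)) x :=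
      ((hasDerivAt_id x).const_mul K).exp
    exact ((((hasDerivAt_mWright x).pow 2).add ((hasDerivAt_mWrightDeriv x).pow 2)).mul
      h3).congr_deriv (by simp; ring)
  have hmono : MonotoneOn e (Icc 0 b) := by
    refine monotoneOn_of_hasDerivWithinAt_nonneg (convex_Icc 0 b)
      (fun x _ => (hd x).continuousAt.continuousWithinAt)
      (fun x _ => (hd x).hasDerivWithinAt) fun x hx => ?_
    rw [interior_Icc] at hx
    refine mul_nonneg ?_ (Real.exp_pos _).le
    have hK : 1 + x / 3 ≤ K := by simp only [K]; linarith [hx.2]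
    have h0 : 0 < 1 + x / 3 := by linarith [hx.1]
    have h1 : (1 + x / 3) * (mWright (1 / 3) x ^ 2 + mWrightDeriv x ^ 2) ≤
        K * (mWright (1 / 3) x ^ 2 + mWrightDeriv x ^ 2) := by gcongr
    have h2 : 0 ≤ (1 + x / 3) * (mWright (1 / 3) x + mWrightDeriv x) ^ 2 := by positivity
    linarith
  have := hmono (left_mem_Icc.2 hb) (right_mem_Icc.2 hb) hb
  have h0 := mWright_zero_pos
  simp only [e, h.1, h.2] at this
  simp at this
  nlinarith [sq_nonneg (mWrightDeriv 0)]

/-- At a zero of M the nondecreasing, nonpositive function M M' has reached 0 and stays there. Its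
derivative M'² + (x/3) M² then vanishes further right, contradicting uniqueness for the differential
equation. -/
lemma mWright_ne_zero {x : ℝ} (hx : 0 ≤ x) : mWright (1 / 3) x ≠ 0 := by
  intro h
  have hz : ∀ y, x ≤ y → mWright (1 / 3) y * mWrightDeriv y = 0 := fun y hy => by
    refine le_antisymm (mWright_mul_deriv_nonpos (hx.trans hy)) ?_
    have := monotoneOn_mWright_mul_deriv hx (hx.trans hy) hy
    simpa only [h, zero_mul] using this
  have h1 := hasDerivAt_mWright_mul_deriv (x + 1)
  have h2 : (fun y => mWright (1 / 3) y * mWrightDeriv y) =ᶠ[𝓝 (x + 1)] fun _ => 0 := by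
    filter_upwards [Ioi_mem_nhds (lt_add_one x)] with y hy using hz y (le_of_lt hy)
  have h3 := h1.unique ((hasDerivAt_const (x + 1) (0 : ℝ)).congr_of_eventuallyEq h2)
  have h4 : 0 ≤ mWrightDeriv (x + 1) ^ 2 := sq_nonneg _
  have h5 : 0 ≤ (x + 1) / 3 * mWright (1 / 3) (x + 1) ^ 2 := by positivity
  rcases mWright_ne_zero_or (b := x + 1) (by positivity) with h | h
  · have : 0 < (x + 1) / 3 * mWright (1 / 3) (x + 1) ^ 2 := by positivity
    linarith
  · have : 0 < mWrightDeriv (x + 1) ^ 2 := by positivity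
    linarith

lemma mWright_pos {x : ℝ} (hx : 0 ≤ x) : 0 < mWright (1 / 3) x := by
  by_contra! h
  obtain ⟨y, hy, hy'⟩ := intermediate_value_Icc' hx continuous_mWright.continuousOn
    (⟨h, mWright_zero_pos.le⟩ : (0 : ℝ) ∈ Icc _ _)
  exact mWright_ne_zero hy.1 hy'

lemma mWrightDeriv_nonpos {x : ℝ} (hx : 0 ≤ x) : mWrightDeriv x ≤ 0 :=
  nonpos_of_mul_nonpos_right (mWright_mul_deriv_nonpos hx) (mWright_pos hx)

/-- The integrand is M'', nonnegative, and M' has a limit at infinity. -/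
lemma integrableOn_mul_mWright {a : ℝ} (ha : 0 ≤ a) :
    IntegrableOn (fun x => x / 3 * mWright (1 / 3) x) (Ioi a) :=
  integrableOn_Ioi_deriv_of_nonneg continuous_mWrightDeriv.continuousWithinAt
    (fun x _ => hasDerivAt_mWrightDeriv x)
    (fun x hx => mul_nonneg (by linarith [mem_Ioi.1 hx]) (mWright_pos (ha.trans hx.le)).le)
    tendsto_mWrightDeriv

lemma integral_mul_mWright {a : ℝ} (ha : 0 ≤ a) :
    ∫ x in Ioi a, x / 3 * mWright (1 / 3) x = -mWrightDeriv a := by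
  rw [integral_Ioi_of_hasDerivAt_of_tendsto continuous_mWrightDeriv.continuousWithinAt
    (fun x _ => hasDerivAt_mWrightDeriv x) (integrableOn_mul_mWright ha) tendsto_mWrightDeriv,
    zero_sub]

/-- The pointwise bound O(1/x) is not enough; beyond 1 the function is dominated by xM instead. -/
lemma integrableOn_mWright : IntegrableOn (mWright (1 / 3)) (Ioi 0) := by
  rw [← Ioc_union_Ioi_eq_Ioi zero_le_one]
  refine (continuous_mWright.integrableOn_Icc.mono_set Ioc_subset_Icc_self).union ?_
  refine ((integrableOn_mul_mWright zero_le_one).const_mul 3).mono'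
    continuous_mWright.aestronglyMeasurable ?_
  filter_upwards [ae_restrict_mem measurableSet_Ioi] with x hx
  have hx : 1 < x := hx
  have hp := mWright_pos (zero_le_one.trans hx.le)
  rw [Real.norm_of_nonneg hp.le]
  nlinarith

lemma integral_mWright_tail_le {x : ℝ} (hx : 0 < x) :
    ∫ t in Ioi x, mWright (1 / 3) t ≤ 3 * (-mWrightDeriv x) / x := by
  rw [← integral_mul_mWright hx.le, ← integral_const_mul, ← integral_div]
  refine setIntegral_mono_on (integrableOn_mWright.mono_set (Ioi_subset_Ioi hx.le))
    (((integrableOn_mul_mWright hx.le).const_mul 3).div_const x) measurableSet_Ioi fun t ht => ?_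
  have hp := mWright_pos (hx.le.trans (le_of_lt ht))
  rw [le_div_iff₀ hx]
  nlinarith [mem_Ioi.1 ht]

/-- The logarithmic derivative of the M-Wright function is at most `-√(x / 3)`. -/
lemma mul_mWright_sq_le (x : ℝ) :
    x / 3 * mWright (1 / 3) x ^ 2 ≤ mWrightDeriv x ^ 2 := by
  set e : ℝ → ℝ := fun y => y / 3 * mWright (1 / 3) y ^ 2 - mWrightDeriv y ^ 2
  -- The cross terms cancel by M'' = (y/3) M, so e increases to its limit 0.
  have hd : ∀ y, HasDerivAt e (1 / 3 * mWright (1 / 3) y ^ 2) y := fun y => by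
    exact ((((hasDerivAt_id y).div_const 3).mul ((hasDerivAt_mWright y).pow 2)).sub
      ((hasDerivAt_mWrightDeriv y).pow 2)).congr_deriv (by simp; ring)
  have hmono : Monotone e := monotone_of_hasDerivAt_nonneg hd fun y => by
    change 0 ≤ 1 / 3 * mWright (1 / 3) y ^ 2; positivity
  have hlim : Tendsto e atTop (𝓝 0) := by
    have h1 : Tendsto (fun y => y / 3 * mWright (1 / 3) y ^ 2) atTop (𝓝 0) := by
      have hb : Tendsto (fun y : ℝ => 1 / 3 * (6 / Real.pi) ^ 2 / y) atTop (𝓝 0) :=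
        tendsto_const_div_atTop_zero _
      refine squeeze_zero_norm' ?_ hb
      filter_upwards [eventually_gt_atTop 0] with y hy
      rw [Real.norm_of_nonneg (by positivity)]
      have := abs_mWright_le hy
      calc y / 3 * mWright (1 / 3) y ^ 2 = y / 3 * |mWright (1 / 3) y| ^ 2 := by rw [sq_abs]
        _ ≤ y / 3 * (3 / Real.pi * (2 / y)) ^ 2 := by gcongr
        _ = _ := by field_simp; ring
    simpa only [zero_pow two_ne_zero, sub_zero] using h1.sub (tendsto_mWrightDeriv.pow 2)
  have := hmono.ge_of_tendsto hlim x
  simp only [e] at this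
  linarith

lemma integral_inv_sq_add_self_add_one :
    IntegrableOn (fun s : ℝ => (s ^ 2 + s + 1)⁻¹) (Ioi 0) ∧
      ∫ s in Ioi (0 : ℝ), (s ^ 2 + s + 1)⁻¹ = 2 * Real.pi / (3 * √3) := by
  have h3 : √3 ^ 2 = (3 : ℝ) := Real.sq_sqrt (by norm_num)
  have hp : 0 < √(3 : ℝ) := by positivity
  set g : ℝ → ℝ := fun s => 2 / √3 * Real.arctan ((2 * s + 1) / √3)
  have hd : ∀ s : ℝ, HasDerivAt g (s ^ 2 + s + 1)⁻¹ s := fun s => by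
    have h1 : HasDerivAt (fun s : ℝ => (2 * s + 1) / √3) (2 * 1 / √3) s :=
      (((hasDerivAt_id s).const_mul 2).add_const 1).div_const _
    refine (h1.arctan.const_mul (2 / √3)).congr_deriv ?_
    have h4 : s ^ 2 + s + 1 ≠ 0 := by nlinarith [sq_nonneg (s + 1 / 2)]
    have h5 : 1 + ((2 * s + 1) / √3) ^ 2 = 4 / 3 * (s ^ 2 + s + 1) := by
      rw [div_pow, h3]; ring
    have h6 : 2 / √3 * (2 * 1 / √3) = 4 / 3 := by
      rw [div_mul_div_comm, ← sq, h3]; norm_num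
    rw [h5, mul_left_comm, h6]
    field_simp
  have hlim : Tendsto g atTop (𝓝 (2 / √3 * (Real.pi / 2))) := by
    refine Tendsto.const_mul _ ((tendsto_nhds_of_tendsto_nhdsWithin
      Real.tendsto_arctan_atTop).comp ?_)
    refine Tendsto.atTop_div_const hp (tendsto_atTop_add_const_right _ _ ?_)
    exact tendsto_id.const_mul_atTop two_pos
  have hnn : ∀ s ∈ Ioi (0 : ℝ), 0 ≤ (s ^ 2 + s + 1)⁻¹ := fun s hs => by
    have : 0 < s := hs
    positivity
  refine ⟨integrableOn_Ioi_deriv_of_nonneg (hd 0).continuousAt.continuousWithinAt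
    (fun s _ => hd s) hnn hlim, ?_⟩
  rw [integral_Ioi_of_hasDerivAt_of_nonneg (hd 0).continuousAt.continuousWithinAt
    (fun s _ => hd s) hnn hlim]
  have h6 : Real.arctan ((2 * 0 + 1) / √3) = Real.pi / 6 := by
    rw [← Real.arctan_tan (x := Real.pi / 6) (by linarith [Real.pi_pos]) (by linarith [Real.pi_pos]),
      Real.tan_pi_div_six]
    norm_num
  simp only [g]
  rw [h6]
  field_simp
  ring

lemma integral_exp_mul_airyKernel {ε r : ℝ} (hε : 0 < ε) (hr : 0 ≤ r) :
    ∫ x in Ioi (0 : ℝ), (Real.exp (-ε * x) : ℂ) * airyKernel 0 x r =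
      (Real.exp (-r ^ 3) : ℂ) * (rootSix / (ε + r * rootSix)) := by
  have hre : (-(ε + r * rootSix : ℂ)).re < 0 := by
    simp [rootSix_re]
    linarith
  have h := integral_exp_mul_complex_Ioi hre 0
  have e : ∀ x : ℝ, (Real.exp (-ε * x) : ℂ) * airyKernel 0 x r =
      (Real.exp (-r ^ 3) : ℂ) * rootSix * Complex.exp (-(ε + r * rootSix) * x) := fun x => by
    rw [airyKernel]
    push_cast
    rw [pow_zero, one_mul, mul_left_comm, ← Complex.exp_add, mul_comm (Complex.exp _) rootSix,
      mul_assoc, ← Complex.exp_add]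
    congr 2
    ring
  simp_rw [e]
  rw [integral_const_mul, h, Complex.ofReal_zero, mul_zero, Complex.exp_zero, neg_div_neg_eq]
  ring

lemma rootSix_div_im {ε r : ℝ} (hε : 0 < ε) (hr : 0 ≤ r) :
    (rootSix / (ε + r * rootSix)).im = √3 / 2 * ε / (r ^ 2 + ε * r + ε ^ 2) := by
  have hn : Complex.normSq (ε + r * rootSix) = r ^ 2 + ε * r + ε ^ 2 := by
    rw [Complex.normSq_apply]
    simp [rootSix_re, rootSix_im]
    have : √3 ^ 2 = (3 : ℝ) := Real.sq_sqrt (by norm_num)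
    linear_combination r ^ 2 / 4 * this
  have : r ^ 2 + ε * r + ε ^ 2 ≠ 0 := by positivity
  rw [Complex.div_im, hn]
  simp [rootSix_re, rootSix_im]
  field_simp
  ring

/-- Fubini applied to the integral representation. The factor exp(-εx) is needed for absolute
convergence: without it the inner integral of the norm behaves like 2/r near r = 0. -/
lemma integral_exp_mul_mWright {ε : ℝ} (hε : 0 < ε) :
    ∫ x in Ioi (0 : ℝ), Real.exp (-ε * x) * mWright (1 / 3) x =
      3 * √3 / (2 * Real.pi) *
        ∫ s in Ioi (0 : ℝ), Real.exp (-(ε * s) ^ 3) * (s ^ 2 + s + 1)⁻¹ := by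
  set μ := (volume : Measure ℝ).restrict (Ioi 0)
  have hint : Integrable (Function.uncurry fun (x r : ℝ) =>
      (Real.exp (-ε * x) : ℂ) * airyKernel 0 x r) (μ.prod μ) := by
    have h1 : Integrable (fun x : ℝ => Real.exp (-ε * x)) μ := exp_neg_integrableOn_Ioi 0 hε
    have h2 := (h1.mul_prod (integrableOn_pow_mul_exp_sub_cube 0 0))
    refine h2.mono' ?_ ?_
    · apply Continuous.aestronglyMeasurable
      have := continuous_airyKernel_uncurry 0
      simp only [Function.uncurry_def]
      fun_prop
    · rw [Measure.prod_restrict]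
      filter_upwards [ae_restrict_mem (measurableSet_Ioi.prod measurableSet_Ioi)] with p hp
      have hp1 : 0 < p.1 := hp.1
      have hp2 : 0 < p.2 := hp.2
      simp only [Function.uncurry_def]
      rw [norm_mul, norm_airyKernel 0 _ hp2.le, Complex.norm_real,
        Real.norm_of_nonneg (Real.exp_pos _).le]
      gcongr
      nlinarith
  have hswap := integral_integral_swap hint
  have hL : ∫ x in Ioi (0 : ℝ), Real.exp (-ε * x) * mWright (1 / 3) x =
      3 / Real.pi * (∫ x, ∫ r, (Real.exp (-ε * x) : ℂ) * airyKernel 0 x r ∂μ ∂μ).im := by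
    have h1 := integral_im hint.integral_prod_left
    have h2 := congrArg (3 / Real.pi * ·) h1
    simp only [← integral_const_mul] at h2
    refine Eq.trans ?_ h2
    refine integral_congr_ae (Eventually.of_forall fun x => ?_)
    simp only [Function.uncurry_def]
    rw [integral_const_mul, mWright_one_third]
    change _ = 3 / Real.pi * ((Real.exp (-ε * x) : ℂ) * airyIntegral 0 x).im
    rw [Complex.im_ofReal_mul]
    ring
  have hR : (∫ r, ∫ x, (Real.exp (-ε * x) : ℂ) * airyKernel 0 x r ∂μ ∂μ).im =
      ∫ r in Ioi (0 : ℝ), Real.exp (-r ^ 3) * (√3 / 2 * ε / (r ^ 2 + ε * r + ε ^ 2)) := by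
    have h1 := integral_im hint.integral_prod_right
    refine Eq.trans h1.symm ?_
    refine setIntegral_congr_fun measurableSet_Ioi fun r hr => ?_
    have hr : 0 < r := hr
    simp only [Function.uncurry_def]
    change (∫ x in Ioi (0 : ℝ), (Real.exp (-ε * x) : ℂ) * airyKernel 0 x r).im = _
    rw [integral_exp_mul_airyKernel hε hr.le, Complex.im_ofReal_mul, rootSix_div_im hε hr.le]
  rw [hL, hswap, hR]
  -- The substitution r = εs removes ε from the rational factor.
  have hsub := integral_comp_mul_left_Ioi
    (fun r : ℝ => Real.exp (-r ^ 3) * (√3 / 2 * ε / (r ^ 2 + ε * r + ε ^ 2))) 0 hε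
  rw [mul_zero, smul_eq_mul, eq_comm, inv_mul_eq_iff_eq_mul₀ hε.ne'] at hsub
  rw [hsub, ← integral_const_mul, ← integral_const_mul, ← integral_const_mul]
  refine setIntegral_congr_fun measurableSet_Ioi fun s hs => ?_
  have hs : 0 < s := hs
  have : (ε * s) ^ 2 + ε * (ε * s) + ε ^ 2 = ε ^ 2 * (s ^ 2 + s + 1) := by ring
  simp only [this]
  field_simp

/-- Abel limit ε → 0+ in the Laplace transform, dominated on one side by M and on the other by 1/(s²
+ s + 1). -/
lemma integral_mWright : ∫ x in Ioi (0 : ℝ), mWright (1 / 3) x = 1 := by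
  obtain ⟨hi, hv⟩ := integral_inv_sq_add_self_add_one
  have h1 : Tendsto (fun ε : ℝ => ∫ x in Ioi (0 : ℝ), Real.exp (-ε * x) * mWright (1 / 3) x)
      (𝓝[>] 0) (𝓝 (∫ x in Ioi (0 : ℝ), mWright (1 / 3) x)) := by
    refine tendsto_integral_filter_of_dominated_convergence (mWright (1 / 3)) ?_ ?_
      integrableOn_mWright ?_
    · refine Eventually.of_forall fun ε => Continuous.aestronglyMeasurable ?_
      have := continuous_mWright
      fun_prop
    · filter_upwards [self_mem_nhdsWithin] with ε hε
      filter_upwards [ae_restrict_mem measurableSet_Ioi] with x hx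
      have hx : 0 < x := hx
      have hε : 0 < ε := hε
      have hp := mWright_pos hx.le
      rw [Real.norm_of_nonneg (by positivity)]
      refine mul_le_of_le_one_left hp.le (Real.exp_le_one_iff.2 ?_)
      nlinarith
    · refine Eventually.of_forall fun x => ?_
      have : Continuous fun ε : ℝ => Real.exp (-ε * x) * mWright (1 / 3) x := by fun_prop
      simpa using (this.tendsto 0).mono_left nhdsWithin_le_nhds
  have h2 : Tendsto (fun ε : ℝ => ∫ s in Ioi (0 : ℝ), Real.exp (-(ε * s) ^ 3) * (s ^ 2 + s + 1)⁻¹)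
      (𝓝[>] 0) (𝓝 (∫ s in Ioi (0 : ℝ), (s ^ 2 + s + 1)⁻¹)) := by
    refine tendsto_integral_filter_of_dominated_convergence _ ?_ ?_ hi ?_
    · exact Eventually.of_forall fun ε => Measurable.aestronglyMeasurable (by fun_prop)
    · filter_upwards [self_mem_nhdsWithin] with ε hε
      filter_upwards [ae_restrict_mem measurableSet_Ioi] with x hx
      have hx : 0 < x := hx
      have hε : 0 < ε := hε
      rw [Real.norm_of_nonneg (by positivity)]
      refine mul_le_of_le_one_left (by positivity) (Real.exp_le_one_iff.2 ?_)
      have : 0 < (ε * x) ^ 3 := by positivity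
      linarith
    · refine Eventually.of_forall fun s => ?_
      have : Continuous fun ε : ℝ => Real.exp (-(ε * s) ^ 3) * (s ^ 2 + s + 1)⁻¹ := by fun_prop
      simpa using (this.tendsto 0).mono_left nhdsWithin_le_nhds
  have h3 := h2.const_mul (3 * √3 / (2 * Real.pi))
  have h4 := tendsto_nhds_unique (h1.congr' ?_) h3
  · rw [h4, hv]
    field_simp
  · filter_upwards [self_mem_nhdsWithin] with ε hε using integral_exp_mul_mWright hε

/-! ### The one-sided law and the Stein identity -/

/-- The distribution on the positive half-line with density `mWright (1 / 3)`. -/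
def mWrightLaw : Measure ℝ :=
  (volume.restrict (Ioi 0)).withDensity fun x => ENNReal.ofReal (mWright (1 / 3) x)

lemma ae_mWright_nonneg : ∀ᵐ x ∂(volume : Measure ℝ).restrict (Ioi 0), 0 ≤ mWright (1 / 3) x := by
  filter_upwards [ae_restrict_mem measurableSet_Ioi] with x hx using (mWright_pos (le_of_lt hx)).le

instance isProbabilityMeasure_mWrightLaw : IsProbabilityMeasure mWrightLaw := by
  constructor
  rw [mWrightLaw, withDensity_apply _ MeasurableSet.univ, Measure.restrict_univ,
    ← ofReal_integral_eq_lintegral_ofReal integrableOn_mWright ae_mWright_nonneg, integral_mWright,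
    ENNReal.ofReal_one]

lemma measurable_ofReal_mWright : Measurable fun x => ENNReal.ofReal (mWright (1 / 3) x) :=
  continuous_mWright.measurable.ennreal_ofReal

lemma toReal_ofReal_mWright_smul (g : ℝ → ℝ) :
    (fun x => (ENNReal.ofReal (mWright (1 / 3) x)).toReal • g x)
      =ᵐ[volume.restrict (Ioi 0)] fun x => g x * mWright (1 / 3) x := by
  filter_upwards [ae_mWright_nonneg] with x hx
  rw [ENNReal.toReal_ofReal hx, smul_eq_mul, mul_comm]

lemma integral_mWrightLaw (g : ℝ → ℝ) :
    ∫ x, g x ∂mWrightLaw = ∫ x in Ioi 0, g x * mWright (1 / 3) x := by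
  rw [mWrightLaw, integral_withDensity_eq_integral_toReal_smul measurable_ofReal_mWright
    (Eventually.of_forall fun _ => ENNReal.ofReal_lt_top)]
  exact integral_congr_ae (toReal_ofReal_mWright_smul g)

lemma integrable_mWrightLaw_iff (g : ℝ → ℝ) :
    Integrable g mWrightLaw ↔ IntegrableOn (fun x => g x * mWright (1 / 3) x) (Ioi 0) := by
  rw [mWrightLaw, integrable_withDensity_iff_integrable_smul' measurable_ofReal_mWright
    (Eventually.of_forall fun _ => ENNReal.ofReal_lt_top)]
  exact integrable_congr (toReal_ofReal_mWright_smul g)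

lemma mWrightLaw_Iic_zero : mWrightLaw (Iic 0) = 0 := by
  rw [mWrightLaw, withDensity_apply _ measurableSet_Iic,
    Measure.restrict_restrict measurableSet_Iic, inter_comm, Ioi_inter_Iic, Ioc_self]
  simp

lemma lintegral_eq_Ioi_add_Ioi_neg (F : ℝ → ENNReal) :
    ∫⁻ x, F x = (∫⁻ x in Ioi 0, F x) + ∫⁻ x in Ioi 0, F (-x) := by
  rw [← lintegral_add_compl F measurableSet_Ioi (μ := volume) (A := Ioi 0), compl_Ioi]
  congr 1
  have h := (Measure.measurePreserving_neg (volume : Measure ℝ)).setLIntegral_comp_preimage_emb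
    (MeasurableEquiv.neg ℝ).measurableEmbedding F (Iic 0)
  rw [← h, setLIntegral_congr (Ioi_ae_eq_Ici (a := (0 : ℝ)))]
  simp

lemma mWrightSymLaw_eq :
    mWrightSymLaw = (1 / 2 : NNReal) • mWrightLaw + (1 / 2 : NNReal) • mWrightLaw.map Neg.neg := by
  ext A hA
  have hN : MeasurableSet (Neg.neg ⁻¹' A : Set ℝ) := measurable_neg hA
  rw [Measure.add_apply, Measure.smul_apply, Measure.smul_apply, Measure.map_apply measurable_neg hA,
    mWrightSymLaw, mWrightLaw, withDensity_apply _ hA, withDensity_apply _ hA,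
    withDensity_apply _ hN, ← lintegral_indicator hA, ← lintegral_indicator hA,
    ← lintegral_indicator hN, lintegral_eq_Ioi_add_Ioi_neg, ENNReal.smul_def, ENNReal.smul_def,
    smul_eq_mul, smul_eq_mul, ← lintegral_const_mul _ (measurable_ofReal_mWright.indicator hA),
    ← lintegral_const_mul _ (measurable_ofReal_mWright.indicator hN)]
  congr 1 <;>
  · refine setLIntegral_congr_fun (measurableSet_Ioi (a := (0 : ℝ))) fun x hx => ?_
    have hx : 0 < x := hx
    by_cases h : x ∈ A <;> by_cases h' : -x ∈ A <;>
      simp [indicator, h, h', mWrightSym, abs_of_pos hx]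

lemma secondDeriv_of_ne_zero {f : ℝ → ℝ} (hf : IsSteinTest f) (c : (ℝ → ℝ) → ℝ) {x : ℝ}
    (hx : x ≠ 0) : secondDeriv c f x = deriv (deriv f) x :=
  if_pos (hf.differentiableAt_deriv x hx)

lemma measurable_steinOp {f : ℝ → ℝ} (hf : IsSteinTest f) (c : (ℝ → ℝ) → ℝ) :
    Measurable (steinOp c f) := by
  have h1 : secondDeriv c f =
      fun x => if x = 0 then secondDeriv c f 0 else deriv (deriv f) x := by
    ext x
    by_cases hx : x = 0
    · simp [hx]
    · simp [hx, secondDeriv_of_ne_zero hf c hx]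
  have h2 : Measurable (secondDeriv c f) := by
    rw [h1]
    exact Measurable.ite (measurableSet_singleton 0) measurable_const (measurable_deriv _)
  have h3 := hf.contDiff.continuous.measurable
  unfold steinOp
  fun_prop

lemma IsSteinTest.comp_neg {f : ℝ → ℝ} (hf : IsSteinTest f) : IsSteinTest fun x => f (-x) := by
  have hd : deriv (fun x => f (-x)) = fun x => -deriv f (-x) := funext fun x => deriv_comp_neg f x
  have hd2 : deriv (deriv fun x => f (-x)) = fun x => deriv (deriv f) (-x) := by
    ext x
    rw [hd, deriv.fun_neg, deriv_comp_neg, neg_neg]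
  refine ⟨hf.contDiff.comp contDiff_neg, ?_, ?_, fun x hx => ?_, ?_, ?_, ?_⟩
  · exact hf.bounded.imp fun C h x => h _
  · rw [hd]
    exact hf.bounded_deriv.imp fun C h x => by simpa using h (-x)
  · rw [hd]
    exact ((hf.differentiableAt_deriv (-x) (neg_ne_zero.2 hx)).comp x
      differentiableAt_id.neg).neg
  · rw [hd2]
    exact hf.continuousOn_deriv2.comp continuousOn_neg fun x hx => neg_ne_zero.2 hx
  · rw [hd2]
    exact hf.bounded_deriv2.imp fun C h x hx => h _ (neg_ne_zero.2 hx)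
  · simpa using hf.map_zero

lemma steinOp_comp_neg {f : ℝ → ℝ} (hf : IsSteinTest f) (c : (ℝ → ℝ) → ℝ) {x : ℝ} (hx : x ≠ 0) :
    steinOp c (fun y => f (-y)) x = steinOp c f (-x) := by
  have hd : deriv (fun x => f (-x)) = fun x => -deriv f (-x) := funext fun x => deriv_comp_neg f x
  rw [steinOp, steinOp, secondDeriv_of_ne_zero hf.comp_neg c hx,
    secondDeriv_of_ne_zero hf c (neg_ne_zero.2 hx), hd, deriv.fun_neg, deriv_comp_neg, neg_neg,
    abs_neg]

/-- The Stein identity on the positive half-line, by two integrations by parts. -/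
lemma integral_steinOp_mWrightLaw {f : ℝ → ℝ} (hf : IsSteinTest f) (c : (ℝ → ℝ) → ℝ) :
    Integrable (steinOp c f) mWrightLaw ∧
      ∫ x, steinOp c f x ∂mWrightLaw = -(deriv f 0 * mWright (1 / 3) 0) := by
  obtain ⟨C₀, h₀⟩ := hf.bounded
  obtain ⟨C₁, h₁⟩ := hf.bounded_deriv
  obtain ⟨C₂, h₂⟩ := hf.bounded_deriv2
  have hcont : Continuous (deriv f) := hf.contDiff.continuous_deriv le_rfl
  have hdf : ∀ x, HasDerivAt f (deriv f x) x := fun x =>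
    (hf.contDiff.differentiable one_ne_zero x).hasDerivAt
  have hint : IntegrableOn (fun x => steinOp c f x * mWright (1 / 3) x) (Ioi 0) := by
    refine ((integrableOn_mWright.const_mul C₂).add
      ((integrableOn_mul_mWright le_rfl).const_mul C₀)).mono'
      ((measurable_steinOp hf c).mul continuous_mWright.measurable).aestronglyMeasurable ?_
    filter_upwards [ae_restrict_mem measurableSet_Ioi] with x hx
    have hx : 0 < x := hx
    have hp := mWright_pos hx.le
    rw [norm_mul, Real.norm_of_nonneg hp.le, steinOp, secondDeriv_of_ne_zero hf c hx.ne',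
      abs_of_pos hx, Real.norm_eq_abs]
    have h3 : |deriv (deriv f) x - 1 / 3 * x * f x| ≤ C₂ + 1 / 3 * x * C₀ := by
      refine (abs_sub _ _).trans (add_le_add (h₂ x hx.ne') ?_)
      rw [abs_mul, abs_of_pos (by positivity : 0 < 1 / 3 * x)]
      gcongr
      exact h₀ x
    calc _ ≤ (C₂ + 1 / 3 * x * C₀) * mWright (1 / 3) x := by gcongr
      _ = _ := by simp only [Pi.add_apply]; ring
  refine ⟨(integrable_mWrightLaw_iff _).2 hint, ?_⟩
  have hlim : Tendsto (fun x => deriv f x * mWright (1 / 3) x - f x * mWrightDeriv x)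
      atTop (𝓝 0) := by
    have h3 : Tendsto (fun x => deriv f x * mWright (1 / 3) x) atTop (𝓝 0) :=
      bdd_le_mul_tendsto_zero' C₁ (Eventually.of_forall h₁) tendsto_mWright
    have h4 : Tendsto (fun x => f x * mWrightDeriv x) atTop (𝓝 0) :=
      bdd_le_mul_tendsto_zero' C₀ (Eventually.of_forall h₀) tendsto_mWrightDeriv
    simpa only [sub_zero] using h3.sub h4
  rw [integral_mWrightLaw, integral_Ioi_of_hasDerivAt_of_tendsto
    -- The Wronskian-type antiderivative of (f'' - xf/3) M; since f(0) = 0, only f'(0) M(0) is left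
    -- at the origin.
    (f := fun x => deriv f x * mWright (1 / 3) x - f x * mWrightDeriv x) ?_ ?_ hint hlim]
  · simp [hf.map_zero]
  · exact ((hcont.mul continuous_mWright).sub
      (hf.contDiff.continuous.mul continuous_mWrightDeriv)).continuousWithinAt
  · intro x hx
    have hx : 0 < x := hx
    refine (((hf.differentiableAt_deriv x hx.ne').hasDerivAt.mul (hasDerivAt_mWright x)).sub
      ((hdf x).mul (hasDerivAt_mWrightDeriv x))).congr_deriv ?_
    rw [steinOp, secondDeriv_of_ne_zero hf c hx.ne', abs_of_pos hx]
    ring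

/-- The boundary terms of f and of its reflection are opposite. The convention at 0 plays no role
because the one-sided law does not charge 0. -/
lemma integral_steinOp_mWrightSymLaw {f : ℝ → ℝ} (hf : IsSteinTest f) (c : (ℝ → ℝ) → ℝ) :
    Integrable (steinOp c f) mWrightSymLaw ∧ ∫ x, steinOp c f x ∂mWrightSymLaw = 0 := by
  obtain ⟨hi₁, hv₁⟩ := integral_steinOp_mWrightLaw hf c
  obtain ⟨hi₂, hv₂⟩ := integral_steinOp_mWrightLaw hf.comp_neg c
  have hae : steinOp c (fun y => f (-y)) =ᵐ[mWrightLaw] fun x => steinOp c f (-x) := by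
    have : ∀ᵐ x ∂mWrightLaw, x ∉ Iic 0 := measure_eq_zero_iff_ae_notMem.1 mWrightLaw_Iic_zero
    filter_upwards [this] with x hx
    exact steinOp_comp_neg hf c fun h => hx h.le
  have hm := (measurable_steinOp hf c).aestronglyMeasurable (μ := mWrightLaw.map Neg.neg)
  have hi₃ : Integrable (steinOp c f) (mWrightLaw.map Neg.neg) :=
    (integrable_map_measure hm measurable_neg.aemeasurable).2 (hi₂.congr hae)
  rw [mWrightSymLaw_eq]
  refine ⟨(hi₁.smul_measure_nnreal).add_measure (hi₃.smul_measure_nnreal), ?_⟩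
  rw [integral_add_measure hi₁.smul_measure_nnreal hi₃.smul_measure_nnreal,
    integral_smul_nnreal_measure, integral_smul_nnreal_measure,
    integral_map measurable_neg.aemeasurable hm, ← integral_congr_ae hae, hv₁, hv₂, deriv_comp_neg,
    neg_zero, ← smul_add]
  simp

/-! ### Solving the Stein equation -/

lemma hasDerivAt_ite_nonneg {a b a' b' : ℝ → ℝ} (ha : ∀ x, 0 ≤ x → HasDerivAt a (a' x) x)
    (hb : ∀ x, x ≤ 0 → HasDerivAt b (b' x) x) (h0 : a 0 = b 0) (h1 : a' 0 = b' 0) (x : ℝ) :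
    HasDerivAt (fun y => if 0 ≤ y then a y else b y) (if 0 ≤ x then a' x else b' x) x := by
  rcases lt_trichotomy x 0 with hx | rfl | hx
  · rw [if_neg hx.not_ge]
    refine (hb x hx.le).congr_of_eventuallyEq ?_
    filter_upwards [Iio_mem_nhds hx] with y hy using if_neg (not_le.2 hy)
  · rw [if_pos le_rfl, ← hasDerivWithinAt_univ, ← Ici_union_Iic (a := (0 : ℝ))]
    refine HasDerivWithinAt.union ?_ ?_
    · exact (ha 0 le_rfl).hasDerivWithinAt.congr (fun y hy => if_pos hy) (if_pos le_rfl)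
    · rw [h1]
      refine (hb 0 le_rfl).hasDerivWithinAt.congr (fun y hy => ?_) (by simpa using h0)
      rcases (show y ≤ 0 from hy).lt_or_eq with h | rfl
      · exact if_neg (not_le.2 h)
      · simpa using h0
  · rw [if_pos hx.le]
    refine (ha x hx.le).congr_of_eventuallyEq ?_
    filter_upwards [Ioi_mem_nhds hx] with y hy using if_pos (le_of_lt hy)

/-- Some point of (x, x + 1) has slope at most 2C by the mean value theorem; returning to x costs at
most D. -/
lemma abs_deriv_le_of_bounded {f p q : ℝ → ℝ} {C D : ℝ} (hf : ∀ x, HasDerivAt f (p x) x)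
    (hp : ∀ x, HasDerivAt p (q x) x) (hC : ∀ x, |f x| ≤ C) (hD : ∀ x, |q x| ≤ D) (x : ℝ) :
    |p x| ≤ 2 * C + D := by
  obtain ⟨ξ, hξ, e⟩ := exists_hasDerivAt_eq_slope f p (lt_add_one x)
    (fun y _ => (hf y).continuousAt.continuousWithinAt) fun y _ => hf y
  rw [add_sub_cancel_left, div_one] at e
  have h1 : ‖p x - p ξ‖ ≤ D * ‖x - ξ‖ := convex_univ.norm_image_sub_le_of_norm_hasDerivWithin_le
    (fun y _ => (hp y).hasDerivWithinAt) (fun y _ => hD y) (mem_univ ξ) (mem_univ x)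
  have hD0 : 0 ≤ D := (abs_nonneg _).trans (hD 0)
  have h2 : ‖x - ξ‖ ≤ 1 := by
    rw [Real.norm_eq_abs, abs_le]
    constructor <;> linarith [hξ.1, hξ.2]
  have h3 : |p ξ| ≤ 2 * C := by
    rw [e]
    exact (abs_sub _ _).trans (by linarith [hC (x + 1), hC x])
  have h4 : |p x| ≤ |p x - p ξ| + |p ξ| := by simpa using abs_add_le (p x - p ξ) (p ξ)
  rw [Real.norm_eq_abs] at h1
  nlinarith

/-- Mean zero replaces the integral over (0, x) by minus the tail, to which the tail bound for M
applies. -/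
lemma abs_primitive_mul_mWright_le {h : ℝ → ℝ} (hc : Continuous h) {B : ℝ} (hB : ∀ x, |h x| ≤ B)
    (hz : ∫ x in Ioi 0, h x * mWright (1 / 3) x = 0) {x : ℝ} (hx : 0 < x) :
    |∫ t in (0 : ℝ)..x, h t * mWright (1 / 3) t| ≤ B * (3 * (-mWrightDeriv x) / x) := by
  have hint : IntegrableOn (fun t => h t * mWright (1 / 3) t) (Ioi 0) :=
    integrableOn_mWright.bdd_mul hc.aestronglyMeasurable (Eventually.of_forall hB)
  have hintx := hint.mono_set (Ioi_subset_Ioi hx.le)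
  have hB0 : 0 ≤ B := (abs_nonneg _).trans (hB 0)
  have e : ∫ t in (0 : ℝ)..x, h t * mWright (1 / 3) t = -∫ t in Ioi x, h t * mWright (1 / 3) t := by
    have := intervalIntegral.integral_interval_add_Ioi hint hintx
    linarith
  rw [e, abs_neg, ← Real.norm_eq_abs]
  calc ‖∫ t in Ioi x, h t * mWright (1 / 3) t‖ ≤ ∫ t in Ioi x, B * mWright (1 / 3) t := by
        refine norm_integral_le_of_norm_le
          ((integrableOn_mWright.mono_set (Ioi_subset_Ioi hx.le)).const_mul B) ?_
        filter_upwards [ae_restrict_mem measurableSet_Ioi] with t ht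
        have hp := mWright_pos (hx.le.trans (le_of_lt ht))
        rw [norm_mul, Real.norm_of_nonneg hp.le]
        gcongr
        exact hB t
    _ = B * ∫ t in Ioi x, mWright (1 / 3) t := integral_const_mul _ _
    _ ≤ _ := by gcongr; exact integral_mWright_tail_le hx

/-- The threshold 3 makes x/3 ≥ 1, so M² ≤ M'² and M ≤ -M'. -/
lemma two_mul_mWright_le {x : ℝ} (hx : 3 ≤ x) : 2 * mWright (1 / 3) x ≤ x * -mWrightDeriv x := by
  have h1 := mul_mWright_sq_le x
  have hp := mWright_pos (x := x) (by linarith)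
  have hn := mWrightDeriv_nonpos (x := x) (by linarith)
  have h2 : mWright (1 / 3) x ≤ -mWrightDeriv x := by
    refine abs_le_of_sq_le_sq' ?_ (by linarith) |>.2
    nlinarith [sq_nonneg (mWright (1 / 3) x)]
  nlinarith

/-- If `u` has derivative `G / M²`, where `G` is bounded by a multiple of the derivative of `M`
divided by `x`, then `u` is bounded by a multiple of `1 / (x M)`. -/
lemma abs_le_of_deriv_bound {u G : ℝ → ℝ} {B : ℝ} (hB : 0 ≤ B)
    (hu : ∀ x, 0 ≤ x → HasDerivAt u (G x / mWright (1 / 3) x ^ 2) x)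
    (hG : ∀ x, 0 < x → |G x| ≤ B * (3 * (-mWrightDeriv x) / x)) {x : ℝ} (hx : 3 ≤ x) :
    |u x| ≤ |u 3| + 6 * B / (x * mWright (1 / 3) x) := by
  -- Comparison function: 2M ≤ -yM' gives F' ≥ 3B(-M')/(yM²) ≥ |u'|, so F - u and F + u are both
  -- nondecreasing on [3, ∞).
  set F : ℝ → ℝ := fun y => 6 * B / (y * mWright (1 / 3) y) with hF
  have hFd : ∀ y, 3 ≤ y → HasDerivAt F (6 * B * (-mWright (1 / 3) y - y * mWrightDeriv y) /
      (y * mWright (1 / 3) y) ^ 2) y := fun y hy => by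
    have hp := mWright_pos (x := y) (by linarith)
    have hy0 : 0 < y := by linarith
    exact ((hasDerivAt_const y (6 * B)).div ((hasDerivAt_id y).mul (hasDerivAt_mWright y))
      (mul_pos hy0 hp).ne').congr_deriv (by simp; ring)
  have hcmp : ∀ y, 3 ≤ y → |G y / mWright (1 / 3) y ^ 2| ≤
      6 * B * (-mWright (1 / 3) y - y * mWrightDeriv y) / (y * mWright (1 / 3) y) ^ 2 := by
    intro y hy
    have hp := mWright_pos (x := y) (by linarith)
    have hy0 : 0 < y := by linarith
    have h2 := two_mul_mWright_le hy
    rw [abs_div, abs_of_pos (by positivity : 0 < mWright (1 / 3) y ^ 2), mul_pow, ← div_div]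
    gcongr
    refine (hG y hy0).trans ?_
    rw [le_div_iff₀ (by positivity)]
    have e : B * (3 * -mWrightDeriv y / y) * y ^ 2 = B * (3 * (y * -mWrightDeriv y)) := by
      field_simp
    rw [e]
    nlinarith
  have hmono₁ : MonotoneOn (fun y => F y - u y) (Ici 3) := by
    refine monotoneOn_of_hasDerivWithinAt_nonneg (convex_Ici 3)
      (fun y hy => ((hFd y hy).sub (hu y (by linarith [mem_Ici.1 hy]))).continuousAt.continuousWithinAt)
      (fun y hy => ((hFd y (interior_subset hy)).sub
        (hu y (by linarith [mem_Ici.1 (interior_subset hy)]))).hasDerivWithinAt) fun y hy => ?_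
    have := (abs_le.1 (hcmp y (interior_subset hy))).2
    linarith
  have hmono₂ : MonotoneOn (fun y => F y + u y) (Ici 3) := by
    refine monotoneOn_of_hasDerivWithinAt_nonneg (convex_Ici 3)
      (fun y hy => ((hFd y hy).add (hu y (by linarith [mem_Ici.1 hy]))).continuousAt.continuousWithinAt)
      (fun y hy => ((hFd y (interior_subset hy)).add
        (hu y (by linarith [mem_Ici.1 (interior_subset hy)]))).hasDerivWithinAt) fun y hy => ?_
    have := (abs_le.1 (hcmp y (interior_subset hy))).1
    linarith
  have h3 : 0 ≤ F 3 := by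
    have := mWright_pos (x := 3) (by norm_num)
    simp only [hF]
    positivity
  have m₁ := hmono₁ self_mem_Ici hx hx
  have m₂ := hmono₂ self_mem_Ici hx hx
  simp only at m₁ m₂
  rw [abs_le]
  constructor <;> linarith [neg_abs_le (u 3), le_abs_self (u 3)]

/-- Variation of constants on the half-line, with vanishing Cauchy data at the origin. -/
lemma exists_half_line_solution {h : ℝ → ℝ} (hc : Continuous h) {B : ℝ} (hB : ∀ x, |h x| ≤ B)
    (hz : ∫ x in Ioi 0, h x * mWright (1 / 3) x = 0) :
    ∃ f p : ℝ → ℝ, f 0 = 0 ∧ p 0 = 0 ∧ (∀ x, 0 ≤ x → HasDerivAt f (p x) x) ∧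
      (∀ x, 0 ≤ x → HasDerivAt p (1 / 3 * |x| * f x + h x) x) ∧
      ∃ C, ∀ x, 0 ≤ x → (1 + x) * |f x| ≤ C := by
  set M := mWright (1 / 3)
  have hMc : Continuous M := continuous_mWright
  have hB0 : 0 ≤ B := (abs_nonneg _).trans (hB 0)
  set G : ℝ → ℝ := fun x => ∫ t in (0 : ℝ)..x, h t * M t
  have hGd : ∀ x, HasDerivAt G (h x * M x) x := fun x =>
    (hc.mul hMc).integral_hasStrictDerivAt 0 x |>.hasDerivAt
  have hGc : Continuous G := continuous_iff_continuousAt.2 fun x => (hGd x).continuousAt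
  -- Truncating the argument at 0 keeps the denominator positive on the whole line, so the primitive
  -- u has a two-sided derivative at 0.
  set v : ℝ → ℝ := fun x => G x / M (max x 0) ^ 2 with hv
  have hvc : Continuous v := hGc.div (by fun_prop) fun x =>
    pow_ne_zero _ (mWright_pos (le_max_right x 0)).ne'
  set u : ℝ → ℝ := fun x => ∫ t in (0 : ℝ)..x, v t
  have hud : ∀ x, 0 ≤ x → HasDerivAt u (G x / M x ^ 2) x := fun x hx => by
    have := (hvc.integral_hasStrictDerivAt 0 x).hasDerivAt
    simpa only [hv, max_eq_left hx] using this
  have hbd := fun x (hx : 3 ≤ x) => abs_le_of_deriv_bound hB0 hud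
    (fun x hx => abs_primitive_mul_mWright_le hc hB hz hx) hx
  have hfd : ∀ x, 0 ≤ x →
      HasDerivAt (fun x => M x * u x) (mWrightDeriv x * u x + G x / M x) x := fun x hx => by
    have hp : M x ≠ 0 := (mWright_pos hx).ne'
    refine ((hasDerivAt_mWright x).mul (hud x hx)).congr_deriv ?_
    change _ + M x * _ = _
    field_simp
  refine ⟨fun x => M x * u x, fun x => mWrightDeriv x * u x + G x / M x, by simp [u], by simp [u, G],
    hfd, fun x hx => ?_, ?_⟩
  · have hp : M x ≠ 0 := (mWright_pos hx).ne'
    refine (((hasDerivAt_mWrightDeriv x).mul (hud x hx)).add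
      ((hGd x).div (hasDerivAt_mWright x) hp)).congr_deriv ?_
    rw [abs_of_nonneg hx]
    change x / 3 * M x * u x + _ + (h x * M x * M x - _) / M x ^ 2 = _
    field_simp
    ring
  · have hcf : ContinuousOn (fun x => (1 + x) * |M x * u x|) (Icc 0 3) := fun x hx =>
      ((continuousAt_const.add continuousAt_id).mul
        (hfd x hx.1).continuousAt.abs).continuousWithinAt
    obtain ⟨C, hC⟩ := isCompact_Icc.exists_bound_of_continuousOn hcf
    -- Compactness covers [0, 3]. Beyond 3, xM ≤ 6 bounds x|Mu|, and 1 + x ≤ 2x accounts for the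
    -- factor 2.
    refine ⟨max C (2 * (|u 3| * 6 + 6 * B)), fun x hx => ?_⟩
    rcases le_total x 3 with h3 | h3
    · exact ((le_abs_self _).trans (hC x ⟨hx, h3⟩)).trans (le_max_left _ _)
    · refine le_trans ?_ (le_max_right _ _)
      have hx0 : 0 < x := by linarith
      have hp : 0 < M x := mWright_pos hx
      have hxM : x * M x ≤ 6 := by
        have h1 := (le_abs_self _).trans (abs_mWright_le hx0)
        have h2 : 3 / Real.pi ≤ 1 := by
          rw [div_le_one Real.pi_pos]; exact Real.pi_gt_three.le
        calc x * M x ≤ x * (3 / Real.pi * (2 / x)) := by gcongr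
          _ = 2 * (3 / Real.pi) := by field_simp
          _ ≤ 6 := by linarith
      have h4 : x * |M x * u x| ≤ |u 3| * 6 + 6 * B := by
        rw [abs_mul, abs_of_pos hp]
        calc x * (M x * |u x|) ≤ x * (M x * (|u 3| + 6 * B / (x * M x))) := by
              gcongr; exact hbd x h3
          _ = |u 3| * (x * M x) + 6 * B := by field_simp
          _ ≤ _ := by gcongr
      have h5 : 1 * |M x * u x| ≤ x * |M x * u x| := by gcongr; linarith
      linarith

/-- The Stein equation is solvable for bounded continuous functions with vanishing mean on both
half-lines. -/
lemma exists_isSteinTest_steinOp_eq {h : ℝ → ℝ} (hc : Continuous h) {B : ℝ} (hB : ∀ x, |h x| ≤ B)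
    (hz₁ : ∫ x, h x ∂mWrightLaw = 0) (hz₂ : ∫ x, h (-x) ∂mWrightLaw = 0) :
    ∃ f, IsSteinTest f ∧ ∀ c, steinOp c f = h := by
  rw [integral_mWrightLaw] at hz₁ hz₂
  obtain ⟨f₁, p₁, hf₁, hp₁, hfd₁, hpd₁, C₁, hC₁⟩ := exists_half_line_solution hc hB hz₁
  obtain ⟨f₂, p₂, hf₂, hp₂, hfd₂, hpd₂, C₂, hC₂⟩ :=
    exists_half_line_solution (hc.comp continuous_neg) (fun x => hB (-x)) hz₂
  set f : ℝ → ℝ := fun x => if 0 ≤ x then f₁ x else f₂ (-x) with hf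
  set p : ℝ → ℝ := fun x => if 0 ≤ x then p₁ x else -p₂ (-x) with hp
  have hfd : ∀ x, HasDerivAt f (p x) x := by
    refine hasDerivAt_ite_nonneg hfd₁ (fun x hx => ?_) (by simp [hf₁, hf₂]) (by simp [hp₁, hp₂])
    exact ((hfd₂ (-x) (by linarith)).comp x (hasDerivAt_neg x)).congr_deriv (by ring)
  have hpd : ∀ x, HasDerivAt p (1 / 3 * |x| * f x + h x) x := by
    intro x
    have := hasDerivAt_ite_nonneg (a := p₁) (b := fun x => -p₂ (-x))
      (b' := fun x => 1 / 3 * |x| * f₂ (-x) + h x) hpd₁ (fun x hx => ?_) (by simp [hp₁, hp₂])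
      (by simp) x
    · refine this.congr_deriv ?_
      simp only [hf]
      split_ifs <;> rfl
    · exact ((hpd₂ (-x) (by linarith)).comp x (hasDerivAt_neg x)).neg.congr_deriv (by simp)
  have hdf : deriv f = p := funext fun x => (hfd x).deriv
  have hdp : deriv p = fun x => 1 / 3 * |x| * f x + h x := funext fun x => (hpd x).deriv
  have hfc : Continuous f := continuous_iff_continuousAt.2 fun x => (hfd x).continuousAt
  have hpc : Continuous p := continuous_iff_continuousAt.2 fun x => (hpd x).continuousAt
  have hC : ∀ x, (1 + |x|) * |f x| ≤ max C₁ C₂ := by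
    intro x
    simp only [hf]
    split_ifs with hx
    · rw [abs_of_nonneg hx]
      exact (hC₁ x hx).trans (le_max_left _ _)
    · rw [abs_of_neg (not_le.1 hx)]
      exact (hC₂ (-x) (by linarith)).trans (le_max_right _ _)
  have hbf : ∀ x, |f x| ≤ max C₁ C₂ := fun x => by
    nlinarith [hC x, mul_nonneg (abs_nonneg x) (abs_nonneg (f x))]
  have hbq : ∀ x, |1 / 3 * |x| * f x + h x| ≤ max C₁ C₂ + B := fun x => by
    refine (abs_add_le _ _).trans (add_le_add ?_ (hB x))
    rw [abs_mul, abs_mul, abs_abs, abs_of_pos (by norm_num : (0 : ℝ) < 1 / 3)]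
    nlinarith [hC x, mul_nonneg (abs_nonneg x) (abs_nonneg (f x)), abs_nonneg (f x)]
  refine ⟨f, ⟨?_, ⟨_, hbf⟩, ?_, ?_, ?_, ?_, ?_⟩, fun c => ?_⟩
  · rw [contDiff_one_iff_deriv, hdf]
    exact ⟨fun x => (hfd x).differentiableAt, hpc⟩
  · rw [hdf]
    exact ⟨_, abs_deriv_le_of_bounded hfd hpd hbf hbq⟩
  · rw [hdf]
    exact fun x _ => (hpd x).differentiableAt
  · rw [hdf, hdp]
    exact Continuous.continuousOn (by fun_prop)
  · rw [hdf, hdp]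
    exact ⟨_, fun x _ => hbq x⟩
  · simp [hf, hf₁]
  · ext x
    -- The glued derivative is differentiable at 0 as well, so the conventional value given by c is
    -- never used.
    rw [steinOp, secondDeriv, hdf, if_pos (hpd x).differentiableAt, (hpd x).deriv]
    ring

/-! ### The characterization -/

open BoundedContinuousFunction in
/-- A finite measure that annihilates all bounded continuous functions with vanishing mean on both
half-lines is a combination of the two one-sided laws. -/
lemma eq_smul_add_smul_of_integral_eq_zero {μ : Measure ℝ} [IsFiniteMeasure μ]
    (hμ : ∀ h : ℝ →ᵇ ℝ, ∫ x, h x ∂mWrightLaw = 0 → ∫ x, h (-x) ∂mWrightLaw = 0 →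
      ∫ x, h x ∂μ = 0) :
    ∃ a b : NNReal, μ = a • mWrightLaw + b • mWrightLaw.map Neg.neg := by
  -- This function has positive mean under the one-sided law and zero mean under its reflection.
  -- Subtracting multiples of g and of its reflection corrects both means of any h independently.
  set g : ℝ →ᵇ ℝ := BoundedContinuousFunction.ofNormedAddCommGroup (fun x => min (max x 0) 1)
    (by fun_prop) 1 (fun x => by
      rw [Real.norm_of_nonneg (by positivity)]; exact min_le_right _ _) with hg
  have hgv : ∀ x, g x = min (max x 0) 1 := fun x => rfl
  have hg0 : ∀ x, 0 ≤ g x := fun x => by rw [hgv]; positivity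
  set nb : (ℝ →ᵇ ℝ) → (ℝ →ᵇ ℝ) := fun h => h.compContinuous ⟨Neg.neg, continuous_neg⟩
  have hnb : ∀ h x, nb h x = h (-x) := fun h x => rfl
  have hae : ∀ᵐ x ∂mWrightLaw, 0 < x := by
    have : ∀ᵐ x ∂mWrightLaw, x ∉ Iic 0 := measure_eq_zero_iff_ae_notMem.1 mWrightLaw_Iic_zero
    filter_upwards [this] with x hx using not_le.1 hx
  set m := ∫ x, g x ∂mWrightLaw with hm
  have hmpos : 0 < m := by
    refine lt_of_le_of_ne (integral_nonneg hg0) fun h0 => ?_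
    have := (integral_eq_zero_iff_of_nonneg hg0 (g.integrable _)).1 h0.symm
    have hfalse : ∀ᵐ x ∂mWrightLaw, False := by
      filter_upwards [this, hae] with x h1 h2
      rw [hgv] at h1
      have : 0 < min (max x 0) 1 := by positivity
      exact this.ne' h1
    have := hfalse.exists
    exact this.choose_spec
  have hgneg : ∫ x, g (-x) ∂mWrightLaw = 0 := by
    refine integral_eq_zero_of_ae ?_
    filter_upwards [hae] with x hx
    rw [hgv, max_eq_right (by linarith)]
    simp
  have hint : ∀ (h : ℝ →ᵇ ℝ) (ν : Measure ℝ) [IsFiniteMeasure ν], Integrable (fun x => h x) ν :=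
    fun h ν _ => h.integrable ν
  have key : ∀ h : ℝ →ᵇ ℝ, ∫ x, h x ∂μ = (∫ x, h x ∂mWrightLaw) / m * ∫ x, g x ∂μ +
      (∫ x, h (-x) ∂mWrightLaw) / m * ∫ x, nb g x ∂μ := by
    intro h
    set α := (∫ x, h x ∂mWrightLaw) / m with hα
    set β := (∫ x, h (-x) ∂mWrightLaw) / m with hβ
    have e : ∀ (ν : Measure ℝ) [IsFiniteMeasure ν] (k : ℝ →ᵇ ℝ) (s t : ℝ →ᵇ ℝ),
        ∫ x, (k x - α * s x - β * t x) ∂ν =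
          ∫ x, k x ∂ν - α * ∫ x, s x ∂ν - β * ∫ x, t x ∂ν := by
      intro ν _ k s t
      rw [integral_sub (f := fun x => k x - α * s x)
        ((hint k ν).sub ((hint s ν).const_mul α)) ((hint t ν).const_mul β),
        integral_sub (hint k ν) ((hint s ν).const_mul α), integral_const_mul, integral_const_mul]
    have h1 := hμ (h - α • g - β • nb g) ?_ ?_
    · have h2 := e μ h g (nb g)
      rw [← h2.symm.trans h1 |> sub_eq_zero.1 |> fun q => (sub_eq_iff_eq_add.1 q).symm]
      ring
    · refine (e mWrightLaw h g (nb g)).trans ?_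
      simp only [hnb]
      rw [hgneg, ← hm, hα]
      field_simp
      ring
    · refine Eq.trans ?_ ((e mWrightLaw (nb h) (nb g) g).trans ?_)
      · refine integral_congr_ae (Eventually.of_forall fun x => ?_)
        simp [hnb]
      · simp only [hnb]
        rw [hgneg, ← hm, hβ]
        field_simp
        ring
  obtain ⟨a, ha⟩ : ∃ a : NNReal, (a : ℝ) = (∫ x, g x ∂μ) / m :=
    ⟨⟨_, div_nonneg (integral_nonneg hg0) hmpos.le⟩, rfl⟩
  obtain ⟨b, hb⟩ : ∃ b : NNReal, (b : ℝ) = (∫ x, nb g x ∂μ) / m :=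
    ⟨⟨_, div_nonneg (integral_nonneg fun x => hg0 _) hmpos.le⟩, rfl⟩
  have := Measure.isFiniteMeasure_map mWrightLaw (Neg.neg : ℝ → ℝ)
  refine ⟨a, b, ext_of_forall_integral_eq_of_IsFiniteMeasure fun h => ?_⟩
  rw [key, integral_add_measure (hint h _).smul_measure_nnreal (hint h _).smul_measure_nnreal,
    integral_smul_nnreal_measure, integral_smul_nnreal_measure,
    integral_map measurable_neg.aemeasurable h.continuous.aestronglyMeasurable,
    NNReal.smul_def, NNReal.smul_def, smul_eq_mul, smul_eq_mul, ha, hb]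
  ring

/-- The one-sided law lives on (0, ∞) and its reflection on (-∞, 0), so the masses of the two
half-lines are the two coefficients. -/
lemma eq_mWrightSymLaw_of_integral_steinOp_eq_zero {μ : Measure ℝ} [IsFiniteMeasure μ]
    (hnonneg : μ (Ici 0) = 1 / 2) (hneg : μ (Iio 0) = 1 / 2) (c : (ℝ → ℝ) → ℝ)
    (hμ : ∀ f, IsSteinTest f → ∫ x, steinOp c f x ∂μ = 0) : μ = mWrightSymLaw := by
  obtain ⟨a, b, rfl⟩ := eq_smul_add_smul_of_integral_eq_zero (μ := μ) fun h h₁ h₂ => by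
    obtain ⟨f, hf, hs⟩ := exists_isSteinTest_steinOp_eq h.continuous h.norm_coe_le_norm h₁ h₂
    rw [← hs c]
    exact hμ f hf
  have hn1 : mWrightLaw (Iio 0) = 0 := measure_mono_null Iio_subset_Iic_self mWrightLaw_Iic_zero
  have hp1 : mWrightLaw (Ioi 0) = 1 := by
    rw [← compl_Iic]
    exact (prob_compl_eq_one_iff measurableSet_Iic).2 mWrightLaw_Iic_zero
  have hp2 : mWrightLaw (Ici 0) = 1 :=
    le_antisymm prob_le_one (hp1 ▸ measure_mono Ioi_subset_Ici_self)
  have hhalf : ∀ a : NNReal, (a : ENNReal) = 1 / 2 → a = 1 / 2 := fun a h => by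
    rw [← ENNReal.coe_inj, h, ENNReal.coe_div two_ne_zero]
    simp
  have ha : a = 1 / 2 := by
    refine hhalf a ?_
    rw [Measure.add_apply, Measure.smul_apply, Measure.smul_apply,
      Measure.map_apply measurable_neg measurableSet_Ici] at hnonneg
    simpa [hp2, mWrightLaw_Iic_zero, ENNReal.smul_def] using hnonneg
  have hb : b = 1 / 2 := by
    refine hhalf b ?_
    rw [Measure.add_apply, Measure.smul_apply, Measure.smul_apply,
      Measure.map_apply measurable_neg measurableSet_Iio] at hneg
    simpa [hp1, hn1, ENNReal.smul_def] using hneg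
  rw [ha, hb, mWrightSymLaw_eq]

end

theorem theorem2 {Ω : Type*} [MeasurableSpace Ω] (P : Measure Ω) [IsProbabilityMeasure P]
    (X : Ω → ℝ) (hX : AEMeasurable X P)
    (hnonneg : P {ω | 0 ≤ X ω} = 1 / 2) (hneg : P {ω | X ω < 0} = 1 / 2)
    (c : (ℝ → ℝ) → ℝ) :
    HasLaw X mWrightSymLaw P ↔
      ∀ f : ℝ → ℝ, IsSteinTest f →
        Integrable (fun ω => steinOp c f (X ω)) P ∧ ∫ ω, steinOp c f (X ω) ∂P = 0 := by
  have hm : ∀ f, IsSteinTest f → AEStronglyMeasurable (steinOp c f) (P.map X) := fun f hf =>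
    (measurable_steinOp hf c).aestronglyMeasurable
  constructor
  · intro h f hf
    have hs := integral_steinOp_mWrightSymLaw hf c
    rw [← h.map_eq, integrable_map_measure (hm f hf) hX, integral_map hX (hm f hf)] at hs
    exact hs
  · intro h
    refine ⟨hX, ?_⟩
    have := Measure.isProbabilityMeasure_map hX
    refine eq_mWrightSymLaw_of_integral_steinOp_eq_zero ?_ ?_ c fun f hf => ?_
    · rw [Measure.map_apply_of_aemeasurable hX measurableSet_Ici]
      exact hnonneg
    · rw [Measure.map_apply_of_aemeasurable hX measurableSet_Iio]
      exact hneg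
    · rw [integral_map hX (hm f hf)]
      exact (h f hf).2
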